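/- Let $\mathbb{M}_{n_1,n_2}$ be the space of $n_1\times n_2$ matrices over $\mathbb{R}$ or $\mathbb{C}$ ($n_1,n_2\ge 1$) with the Frobenius norm and the real scalar product $\operatorname{Re}\operatorname{tr}(X^*Y)$. Let $\mathcal{A}:\mathbb{M}_{n_1,n_2}\to H$ be a (real-)linear operator into a finite-dimensional real inner product space $H$ (for example $H=\mathbb{R}^m$, or $H=\mathbb{C}^m$ with the real part of its inner product), let $b\in H$, $\mu\ge 0$ and let $K\ge 1$ be an integer. Define $\delta_{2K}^-$ by $$1-\delta_{2K}^-=\inf\left\{\frac{\|\mathcal{A}X\|^2}{\|X\|^2}:\ X\ne 0,\ \operatorname{rank}(X)\le 2K\right\}$$ and assume $\delta_{2K}^-<1$. For a nonnegative functional $f$ on $\mathbb{M}_{n_1,n_2}$ put $\mathcal{S}_2(f)(Y)=\sup_X\big(-f(X)-\|X-Y\|^2\big)$ and let $\mathcal{Q}_2(f)=\mathcal{S}_2(\mathcal{S}_2(f))$ be its quadratic envelope. Set $$\mathcal{R}_\mu(X)=\mu\operatorname{rank}(X)+\|\mathcal{A}X-b\|^2,\qquad \mathcal{R}_{\mu,reg}(X)=\mathcal{Q}_2(\mu\operatorname{rank})(X)+\|\mathcal{A}X-b\|^2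 .$$ A point $X$ is called stationary for a functional $g$ if $\liminf_{Y\to X,\,Y\ne X}\frac{g(Y)-g(X)}{\|Y-X\|}\ge 0$. Let $X'$ be a stationary point of $\mathcal{R}_{\mu,reg}$ with $\operatorname{rank}(X')\le K$, let $Z'=(I-\mathcal{A}^*\mathcal{A})X'+\mathcal{A}^*b$, and assume that the singular values of $Z'$ satisfy $$\sigma_i(Z')\notin\left[(1-\delta_{2K}^-)\sqrt{\mu},\ \frac{1}{1-\delta_{2K}^-}\sqrt{\mu}\right]\qquad (1\le i\le \min(n_1,n_2)).$$ Then $X'$ is the unique solution of $\operatorname{argmin}_{\operatorname{rank}(X)\le K}\mathcal{R}_{\mu,reg}(X)$, and every stationary point $X''\ne X'$ of $\mathcal{R}_{\mu,reg}$ satisfies $\operatorname{rank}(X'')>K$. If, in addition, the operator norm satisfies $\|\mathcal{A}\|<1$ and $\|\mathcal{A}X'-b\|^2\le\mu$, then $X'$ is a global minimizer of both $\mathcal{R}_\mu$ and $\mathcal{R}_{\mu,reg}$. -/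

import Mathlib

open Filter Topology
open scoped Matrix.Norms.Frobenius

noncomputable section

namespace RankReg

/-- The real Frobenius scalar product `Re tr(Xᴴ Y)` on real or complex matrices; its norm is
Mathlib's Frobenius norm. -/
instance frobeniusInner {𝕜 : Type*} [RCLike 𝕜] {n₁ n₂ : ℕ} :
    InnerProductSpace ℝ (Matrix (Fin n₁) (Fin n₂) 𝕜) where
  inner X Y := RCLike.re (Matrix.trace (Matrix.conjTranspose X * Y))
  norm_sq_eq_re_inner X := by
    have h0 : 0 ≤ ∑ i, ∑ j, ‖X i j‖ ^ 2 :=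
      Finset.sum_nonneg fun i _ => Finset.sum_nonneg fun j _ => by positivity
    rw [Matrix.frobenius_norm_def, ← Real.sqrt_eq_rpow]
    simp only [Real.rpow_two]
    rw [Real.sq_sqrt h0, Finset.sum_comm]
    simp only [Matrix.trace, Matrix.diag_apply, Matrix.mul_apply, Matrix.conjTranspose_apply,
      map_sum]
    refine Finset.sum_congr rfl fun j _ => Finset.sum_congr rfl fun i _ => ?_
    rw [RCLike.star_def, RCLike.conj_mul]
    norm_cast
  conj_inner_symm X Y := by
    have h : Matrix.trace (Matrix.conjTranspose X * Y)
        = star (Matrix.trace (Matrix.conjTranspose Y * X)) := by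
      rw [← Matrix.trace_conjTranspose]; simp
    simp [h]
  add_left X Y Z := by simp [Matrix.add_mul]
  smul_left X Y r := by
    simp [Matrix.conjTranspose_smul, Matrix.smul_mul, Matrix.trace_smul, RCLike.smul_re]

/-- The transform `S_γ(f)(y) = sup_x (-f(x) - (γ/2) ‖x - y‖²)`. -/
def sTransform {V : Type*} [NormedAddCommGroup V] (γ : ℝ) (f : V → ℝ) (y : V) : ℝ :=
  ⨆ x, (-f x - γ / 2 * ‖x - y‖ ^ 2)

/-- The quadratic envelope `Q_γ = S_γ ∘ S_γ`. For real-valued `f ≥ 0` and `γ ≥ 0` both suprema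
are over nonempty sets that are bounded above. -/
def quadEnvelope {V : Type*} [NormedAddCommGroup V] (γ : ℝ) (f : V → ℝ) : V → ℝ :=
  sTransform γ (sTransform γ f)

/-- `x` is a stationary point of `g` if
`liminf_{y → x, y ≠ x} (g(y) - g(x)) / ‖y - x‖ ≥ 0` (limit inferior in the extended reals). -/
def IsStationary {V : Type*} [NormedAddCommGroup V] (g : V → ℝ) (x : V) : Prop :=
  0 ≤ liminf (fun y => (((g y - g x) / ‖y - x‖ : ℝ) : EReal)) (𝓝[≠] x)

section Operators

variable {V H : Type*} [NormedAddCommGroup V] [InnerProductSpace ℝ V] [FiniteDimensional ℝ V]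
  [NormedAddCommGroup H] [InnerProductSpace ℝ H] [FiniteDimensional ℝ H]

/-- The operator norm of a linear operator between finite-dimensional spaces. -/
def opNorm (A : V →ₗ[ℝ] H) : ℝ :=
  ‖LinearMap.toContinuousLinearMap A‖

/-- The point `Z = (I - A*A) X + A* b`. For complex matrices the adjoint is taken with respect to
the real scalar products `Re ⟨·,·⟩`; if `A` is complex linear it is the complex adjoint. -/
def zPoint (A : V →ₗ[ℝ] H) (b : H) (X : V) : V :=
  X - LinearMap.adjoint A (A X) + LinearMap.adjoint A b

end Operators

section Matrices

variable {𝕜 : Type*} [RCLike 𝕜] {n₁ n₂ : ℕ}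
  {H : Type*} [NormedAddCommGroup H] [InnerProductSpace ℝ H]

/-- The singular values of a matrix in non-increasing order with multiplicity, indexed by
`0, …, min n₁ n₂ - 1`. -/
def sigma (Z : Matrix (Fin n₁) (Fin n₂) 𝕜) (i : Fin (min n₁ n₂)) : ℝ :=
  (Matrix.toEuclideanLin Z).singularValues i

/-- The lower restricted isometry constant `δ_K⁻` of `A`, defined by
`1 - δ_K⁻ = inf {‖A X‖² / ‖X‖² : X ≠ 0, rank X ≤ K}`. The set is bounded below by `0`, and it is
nonempty as soon as `K`, `n₁`, `n₂` are positive. -/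
def lrip (A : Matrix (Fin n₁) (Fin n₂) 𝕜 →ₗ[ℝ] H) (K : ℕ) : ℝ :=
  1 - sInf {r : ℝ | ∃ X : Matrix (Fin n₁) (Fin n₂) 𝕜,
    X ≠ 0 ∧ X.rank ≤ K ∧ r = ‖A X‖ ^ 2 / ‖X‖ ^ 2}

/-- The functional `μ rank(X) + ‖A X - b‖²`. -/
def rankFunctional (μ : ℝ) (A : Matrix (Fin n₁) (Fin n₂) 𝕜 →ₗ[ℝ] H) (b : H)
    (X : Matrix (Fin n₁) (Fin n₂) 𝕜) : ℝ :=
  μ * (X.rank : ℝ) + ‖A X - b‖ ^ 2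

/-- The functional `Q₂(μ rank)(X) + ‖A X - b‖²`. -/
def regFunctional (μ : ℝ) (A : Matrix (Fin n₁) (Fin n₂) 𝕜 →ₗ[ℝ] H) (b : H)
    (X : Matrix (Fin n₁) (Fin n₂) 𝕜) : ℝ :=
  quadEnvelope 2 (fun Y : Matrix (Fin n₁) (Fin n₂) 𝕜 => μ * (Y.rank : ℝ)) X + ‖A X - b‖ ^ 2

end Matrices

end RankReg

end

/-
At a stationary point `X` of the regularized functional, `‖A · - b‖²` and `‖· - Z‖²` with
`Z = zPoint A b X` have the same differential, and adding `‖· - Z‖²` to the envelope gives a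
convex function; so `X` is a proximal point of `Z` for the envelope. A Hermitian dilation turns
singular values into eigenvalues, and averaging against the doubly stochastic matrix of squared
overlaps of two eigenbases reduces the matrix inequalities to scalar ones for
`s² - (s - |t|)₊²`, `s = √μ`, whose proximal map is hard thresholding at `s`. Singular values of `Z`
outside the closed window leave room for some `c < 1 - δ` with none of them between `c s` and
`s / c`, and this makes the proximal point stable with modulus `1 - c > δ`: more than the convexity
that `A` can lose on differences of matrices of rank at most `K`. At such a proximal point the
envelope agrees with `μ rank`, and for a contraction `A` both functionals have the same infimum,
which is how minimality passes from one to the other.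
-/

namespace RankReg

noncomputable section

section Stationary

variable {V : Type*} [NormedAddCommGroup V] {g h : V → ℝ} {x : V}

lemma IsStationary.eventually_sub_le (hg : IsStationary g x) {ε : ℝ} (hε : 0 < ε) :
    ∀ᶠ y in 𝓝 x, g x - ε * ‖y - x‖ ≤ g y := by
  have hlim : ((-ε : ℝ) : EReal) <
      liminf (fun y => (((g y - g x) / ‖y - x‖ : ℝ) : EReal)) (𝓝[≠] x) :=
    lt_of_lt_of_le (EReal.coe_neg'.2 (neg_lt_zero.2 hε)) hg
  filter_upwards [eventually_nhdsWithin_iff.1 (eventually_lt_of_lt_liminf hlim)] with y hy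
  rcases eq_or_ne y x with rfl | hne
  · simp
  · have hpos : 0 < ‖y - x‖ := norm_pos_iff.2 (sub_ne_zero.2 hne)
    have := (lt_div_iff₀ hpos).1 (EReal.coe_lt_coe_iff.1 (hy hne))
    linarith

lemma IsStationary.isMinOn_of_isLittleO [NormedSpace ℝ V] (hg : IsStationary g x)
    (hh : ConvexOn ℝ Set.univ h)
    (hgh : (fun y => (h y - h x) - (g y - g x)) =o[𝓝 x] fun y => y - x) :
    IsMinOn h Set.univ x := by
  have key (ε : ℝ) (hε : 0 < ε) (y : V) : h x ≤ h y + 2 * ε * ‖y - x‖ := by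
    have hconv : ConvexOn ℝ Set.univ fun y => h y + 2 * ε * ‖y - x‖ := by
      simp only [← dist_eq_norm]
      exact hh.add ((convexOn_univ_dist x).smul (by positivity : (0 : ℝ) ≤ 2 * ε))
    have hloc : IsLocalMin (fun y => h y + 2 * ε * ‖y - x‖) x := by
      filter_upwards [hg.eventually_sub_le hε, hgh.bound hε] with y hgy hy
      have := neg_le_of_abs_le hy
      simp only [sub_self, norm_zero, mul_zero, add_zero]
      linarith
    simpa using IsMinOn.of_isLocalMin_of_convex_univ hloc hconv y
  intro y _
  change h x ≤ h y
  refine le_of_forall_pos_le_add fun ε hε => ?_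
  have hnorm : 0 < 2 * (‖y - x‖ + 1) := by positivity
  have hbound : 2 * (ε / (2 * (‖y - x‖ + 1))) * ‖y - x‖ ≤ ε := by
    rw [mul_div_assoc', div_mul_eq_mul_div, div_le_iff₀ hnorm]
    linarith
  linarith [key _ (div_pos hε hnorm) y]

end Stationary

section Envelope

section Norm

variable {V : Type*} [NormedAddCommGroup V] {γ : ℝ} {f : V → ℝ}

lemma bddAbove_range_sTransform (hγ : 0 ≤ γ) (hf : BddBelow (Set.range f)) (y : V) :
    BddAbove (Set.range fun x => -f x - γ / 2 * ‖x - y‖ ^ 2) := by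
  obtain ⟨m, hm⟩ := hf
  refine ⟨-m, Set.forall_mem_range.2 fun x => ?_⟩
  have := hm (Set.mem_range_self x)
  have : 0 ≤ γ / 2 * ‖x - y‖ ^ 2 := by positivity
  linarith

lemma le_sTransform (hγ : 0 ≤ γ) (hf : BddBelow (Set.range f)) (x y : V) :
    -f x - γ / 2 * ‖x - y‖ ^ 2 ≤ sTransform γ f y :=
  le_ciSup (bddAbove_range_sTransform hγ hf y) x

lemma neg_sTransform_sub_le (hγ : 0 ≤ γ) (hf : BddBelow (Set.range f)) (x y : V) :
    -sTransform γ f y - γ / 2 * ‖y - x‖ ^ 2 ≤ f x := by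
  rw [norm_sub_rev]
  linarith [le_sTransform hγ hf x y]

lemma le_quadEnvelope (hγ : 0 ≤ γ) (hf : BddBelow (Set.range f)) (x y : V) :
    -sTransform γ f y - γ / 2 * ‖y - x‖ ^ 2 ≤ quadEnvelope γ f x :=
  le_ciSup (f := fun y => -sTransform γ f y - γ / 2 * ‖y - x‖ ^ 2)
    ⟨f x, Set.forall_mem_range.2 fun y => neg_sTransform_sub_le hγ hf x y⟩ y

lemma quadEnvelope_le (hγ : 0 ≤ γ) (hf : BddBelow (Set.range f)) (x : V) :
    quadEnvelope γ f x ≤ f x :=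
  ciSup_le fun y => neg_sTransform_sub_le hγ hf x y

end Norm

variable {V : Type*} [NormedAddCommGroup V] [InnerProductSpace ℝ V] {γ : ℝ} {f : V → ℝ}

/- The quadratic terms in `x` cancel, so this is a supremum of affine functions of `x`. -/
lemma convexOn_quadEnvelope_add (hγ : 0 ≤ γ) (hf : BddBelow (Set.range f)) (z : V) :
    ConvexOn ℝ Set.univ fun x => quadEnvelope γ f x + γ / 2 * ‖x - z‖ ^ 2 := by
  refine ⟨convex_univ, fun x₁ _ x₂ _ a₁ a₂ ha₁ ha₂ ha => ?_⟩
  simp only [smul_eq_mul]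
  have hsum (u : V) (k : ℝ) : inner ℝ (a₁ • x₁ + a₂ • x₂) u + k =
      a₁ * (inner ℝ x₁ u + k) + a₂ * (inner ℝ x₂ u + k) := by
    rw [inner_add_left, real_inner_smul_left, real_inner_smul_left]
    linear_combination (-k) * ha
  rw [← le_sub_iff_add_le]
  refine ciSup_le fun y => ?_
  have haffine (x : V) : γ / 2 * ‖x - z‖ ^ 2 - γ / 2 * ‖y - x‖ ^ 2 =
      inner ℝ x (γ • (y - z)) + γ / 2 * (‖z‖ ^ 2 - ‖y‖ ^ 2) := by
    rw [norm_sub_sq_real, norm_sub_sq_real, real_inner_smul_right, inner_sub_right,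
      real_inner_comm x y]
    ring
  have h₁ := mul_le_mul_of_nonneg_left (le_quadEnvelope hγ hf x₁ y) ha₁
  have h₂ := mul_le_mul_of_nonneg_left (le_quadEnvelope hγ hf x₂ y) ha₂
  have h := hsum (γ • (y - z)) (γ / 2 * (‖z‖ ^ 2 - ‖y‖ ^ 2))
  rw [← haffine, ← haffine, ← haffine] at h
  have hS : sTransform γ f y = a₁ * sTransform γ f y + a₂ * sTransform γ f y := by
    rw [← add_mul, ha, one_mul]
  linarith

end Envelope

section ProximalPoint

/-- `w ↦ q w + ‖w - z‖²` grows at least by `κ ‖w - x‖²` away from `x`. For `κ = 0` this says that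
`x` is a proximal point of `z` for `q`, i.e. that `2 z` is a subgradient of `q + ‖·‖²` at `x`. -/
def HasProxGrowth {V : Type*} [NormedAddCommGroup V] (q : V → ℝ) (κ : ℝ) (z x : V) : Prop :=
  ∀ w, q x + ‖x - z‖ ^ 2 + κ * ‖w - x‖ ^ 2 ≤ q w + ‖w - z‖ ^ 2

variable {V : Type*} [NormedAddCommGroup V] [InnerProductSpace ℝ V] {q : V → ℝ}

lemma HasProxGrowth.inner_sub_nonneg {z z' x x' : V} (h : HasProxGrowth q 0 z x)
    (h' : HasProxGrowth q 0 z' x') : 0 ≤ inner ℝ (z - z') (x - x') := by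
  have key : ‖x' - z‖ ^ 2 - ‖x - z‖ ^ 2 + (‖x - z'‖ ^ 2 - ‖x' - z'‖ ^ 2) =
      2 * inner ℝ (z - z') (x - x') := by
    simp only [norm_sub_sq_real, inner_sub_left, inner_sub_right, real_inner_comm]
    ring
  linarith [h x', h' x]

lemma HasProxGrowth.eq_of_add_eq_add {z z' x x' : V} (h : HasProxGrowth q 0 z x)
    (h' : HasProxGrowth q 0 z' x') (hadd : x + z = x' + z') : x = x' ∧ z = z' := by
  have hz : z - z' = -(x - x') := by
    rw [← sub_eq_zero] at hadd ⊢
    rw [← hadd]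
    abel
  have hinner := h.inner_sub_nonneg h'
  rw [hz, inner_neg_left, real_inner_self_eq_norm_sq] at hinner
  have hx : x - x' = 0 := by
    rw [← norm_eq_zero, ← sq_eq_zero_iff]
    nlinarith [sq_nonneg ‖x - x'‖]
  exact ⟨sub_eq_zero.1 hx, sub_eq_zero.1 (by rw [hz, hx, neg_zero])⟩

variable [FiniteDimensional ℝ V]
  {H : Type*} [NormedAddCommGroup H] [InnerProductSpace ℝ H] (A : V →ₗ[ℝ] H)

lemma isLittleO_norm_sq_sub_norm_map_sq (x : V) :
    (fun y => ‖y - x‖ ^ 2 - ‖A (y - x)‖ ^ 2) =o[𝓝 x] fun y => y - x := by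
  have hid : (fun v : V => ‖v‖ ^ 2) =o[𝓝 0] fun v => v :=
    Asymptotics.isLittleO_norm_pow_id one_lt_two
  have hA : (fun v : V => ‖A v‖ ^ 2) =O[𝓝 0] fun v => ‖v‖ ^ 2 :=
    ((LinearMap.toContinuousLinearMap A).isBigO_id (𝓝 0)).norm_norm.pow 2
  exact (hid.sub (hA.trans_isLittleO hid)).comp_tendsto (tendsto_sub_nhds_zero_iff.2 tendsto_id)

variable [FiniteDimensional ℝ H] (b : H)

lemma norm_residual_sub_norm_sub_zPoint (x w : V) :
    ‖A w - b‖ ^ 2 - ‖w - zPoint A b x‖ ^ 2 =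
      ‖A x - b‖ ^ 2 - ‖x - zPoint A b x‖ ^ 2 + (‖A (w - x)‖ ^ 2 - ‖w - x‖ ^ 2) := by
  have hA : A w - b = (A x - b) + A (w - x) := by rw [map_sub]; abel
  have hw : w - zPoint A b x = (x - zPoint A b x) + (w - x) := by abel
  have hz : x - zPoint A b x = LinearMap.adjoint A (A x - b) := by rw [zPoint, map_sub]; abel
  rw [hA, hw, norm_add_sq_real, norm_add_sq_real, hz, LinearMap.adjoint_inner_left]
  ring

lemma inner_zPoint_sub_zPoint (x y : V) :
    inner ℝ (zPoint A b x - zPoint A b y) (x - y) = ‖x - y‖ ^ 2 - ‖A (x - y)‖ ^ 2 := by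
  have hz : zPoint A b x - zPoint A b y = (x - y) - LinearMap.adjoint A (A (x - y)) := by
    simp only [zPoint, map_sub]
    abel
  rw [hz, inner_sub_left, LinearMap.adjoint_inner_left, real_inner_self_eq_norm_sq,
    real_inner_self_eq_norm_sq]

variable {A b}

/- `‖A y - b‖²` and `‖y - z‖²` agree to first order at `x` for `z = zPoint A b x`, and adding the
latter to the envelope gives a convex function. -/
lemma IsStationary.hasProxGrowth {f : V → ℝ} (hf : BddBelow (Set.range f)) {x : V}
    (hx : IsStationary (fun y => quadEnvelope 2 f y + ‖A y - b‖ ^ 2) x) :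
    HasProxGrowth (quadEnvelope 2 f) 0 (zPoint A b x) x := by
  have hmin := hx.isMinOn_of_isLittleO (convexOn_quadEnvelope_add zero_le_two hf (zPoint A b x)) <|
    (isLittleO_norm_sq_sub_norm_map_sq A x).congr_left fun y => by
      linarith [norm_residual_sub_norm_sub_zPoint A b x y]
  intro w
  have : quadEnvelope 2 f x + 2 / 2 * ‖x - zPoint A b x‖ ^ 2 ≤
    quadEnvelope 2 f w + 2 / 2 * ‖w - zPoint A b x‖ ^ 2 := hmin (Set.mem_univ w)
  linarith

lemma HasProxGrowth.add_residual_le {κ : ℝ} {x : V} (h : HasProxGrowth q κ (zPoint A b x) x)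
    (w : V) :
    q x + ‖A x - b‖ ^ 2 + (‖A (w - x)‖ ^ 2 - (1 - κ) * ‖w - x‖ ^ 2) ≤ q w + ‖A w - b‖ ^ 2 := by
  linarith [h w, norm_residual_sub_norm_sub_zPoint A b x w]

/- For a contraction, the quadratic minorant of the envelope at `zPoint A b x` is already large
enough. -/
lemma le_quadEnvelope_add_of_contraction (hA : ∀ v, ‖A v‖ ≤ ‖v‖) {f : V → ℝ}
    (hf : BddBelow (Set.range f)) {m : ℝ} (hm : ∀ w, m ≤ f w + ‖A w - b‖ ^ 2) (x : V) :
    m ≤ quadEnvelope 2 f x + ‖A x - b‖ ^ 2 := by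
  have hS : sTransform 2 f (zPoint A b x) ≤ ‖A x - b‖ ^ 2 - ‖x - zPoint A b x‖ ^ 2 - m := by
    refine ciSup_le fun w => ?_
    have := pow_le_pow_left₀ (norm_nonneg _) (hA (w - x)) 2
    linarith [hm w, norm_residual_sub_norm_sub_zPoint A b x w]
  have hQ := le_quadEnvelope zero_le_two hf x (zPoint A b x)
  rw [norm_sub_rev] at hQ
  linarith

end ProximalPoint

section Scalar

variable {s c x x' z z' : ℝ}

/-- The quadratic envelope of the scalar rank penalty `t ↦ s² · [t ≠ 0]`, i.e. the function
`s² - (s - |t|)₊²`. -/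
def scalarEnvelope (s t : ℝ) : ℝ :=
  s ^ 2 - max (s - |t|) 0 ^ 2

/-- `z - x` is a subgradient of `(s - |x|)₊ |·|` at `x`; this characterises the proximal points `x`
of `z` for `scalarEnvelope s`. -/
def ScalarProx (s z x : ℝ) : Prop :=
  |z - x| ≤ max (s - |x|) 0 ∧ max (s - |x|) 0 * |x| ≤ (z - x) * x

/-- `z` stays clear of the threshold `s` by the factor `c`, and `x` is its hard thresholding. -/
def Thresholded (s c z x : ℝ) : Prop :=
  (x = 0 ∧ |z| ≤ c * s) ∨ (x = z ∧ s ≤ c * |z|)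

lemma mul_le_mul_abs_of_abs_le {a k : ℝ} (h : |a| ≤ k) (t : ℝ) : a * t ≤ k * |t| :=
  (le_abs_self _).trans <| (abs_mul a t).trans_le <| mul_le_mul_of_nonneg_right h (abs_nonneg t)

lemma hasProxGrowth_scalar_iff {q : ℝ → ℝ} {κ z x : ℝ} : HasProxGrowth q κ z x ↔
    ∀ w, q x + (x - z) ^ 2 + κ * (w - x) ^ 2 ≤ q w + (w - z) ^ 2 := by
  simp only [HasProxGrowth, Real.norm_eq_abs, sq_abs]

lemma scalarEnvelope_nonneg (hs : 0 ≤ s) (t : ℝ) : 0 ≤ scalarEnvelope s t :=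
  sub_nonneg.2 <| pow_le_pow_left₀ (le_max_right _ _)
    (max_le (sub_le_self s (abs_nonneg t)) hs) 2

lemma two_mul_abs_le_scalarEnvelope_add_sq (s t : ℝ) :
    2 * s * |t| ≤ scalarEnvelope s t + t ^ 2 := by
  rw [scalarEnvelope, ← sq_abs t]
  rcases max_cases (s - |t|) 0 with ⟨h, -⟩ | ⟨h, -⟩ <;> rw [h]
  · linarith
  · linarith [two_mul_le_add_sq s |t|]

lemma ScalarProx.hasProxGrowth (h : ScalarProx s z x) :
    HasProxGrowth (scalarEnvelope s) 0 z x := by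
  rw [hasProxGrowth_scalar_iff]
  intro w
  obtain ⟨hle, hx⟩ := h
  unfold scalarEnvelope
  set r := max (s - |x|) 0
  have hw : (z - x) * w ≤ r * |w| := mul_le_mul_abs_of_abs_le hle w
  have hgap : max (s - |w|) 0 ^ 2 ≤ (r + (|x| - |w|)) ^ 2 := by
    rcases max_cases (s - |w|) 0 with ⟨h, h'⟩ | ⟨h, -⟩ <;> rw [h]
    · exact pow_le_pow_left₀ h' (by linarith [le_max_left (s - |x|) 0]) 2
    · rw [zero_pow two_ne_zero]
      positivity
  have hsq : (|x| - |w|) ^ 2 ≤ (w - x) ^ 2 := by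
    rw [sub_sq_comm w]
    exact sq_le_sq.2 (abs_abs_sub_abs_le x w)
  linarith

lemma ScalarProx.neg (h : ScalarProx s z x) : ScalarProx s (-z) (-x) := by
  obtain ⟨hle, hx⟩ := h
  refine ⟨?_, ?_⟩
  · rwa [neg_sub_neg, abs_sub_comm, abs_neg]
  · rwa [abs_neg, neg_sub_neg, mul_neg, ← neg_mul, neg_sub]

/-- The map `x + z ↦ x` for `x` a proximal point of `z`: the inverse of
`id + ∂(scalarEnvelope s + (·)²) / 2`. -/
def scalarResolvent (s p : ℝ) : ℝ :=
  max (min (p - s) (p / 2)) 0 - max (min (-p - s) (-p / 2)) 0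

lemma scalarResolvent_neg (s p : ℝ) : scalarResolvent s (-p) = -scalarResolvent s p := by
  simp only [scalarResolvent, neg_neg, neg_sub]

lemma scalarProx_scalarResolvent (hs : 0 ≤ s) (p : ℝ) :
    ScalarProx s (p - scalarResolvent s p) (scalarResolvent s p) := by
  wlog hp : 0 ≤ p generalizing p
  · simpa [scalarResolvent_neg, sub_eq_add_neg, add_comm] using (this (-p) (by linarith)).neg
  have hzero : max (min (-p - s) (-p / 2)) 0 = 0 := max_eq_right (min_le_of_left_le (by linarith))
  rw [scalarResolvent, hzero, sub_zero, ScalarProx]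
  rcases le_total p s with hps | hps
  · rw [max_eq_right (min_le_of_left_le (by linarith))]
    simpa [abs_of_nonneg hp, hs] using hps
  rcases le_total p (2 * s) with hps' | hps'
  · rw [min_eq_left (by linarith), max_eq_left (by linarith : 0 ≤ p - s),
      abs_of_nonneg (by linarith : 0 ≤ p - s), max_eq_left (by linarith),
      abs_of_nonneg (by linarith)]
    constructor <;> linarith
  · rw [min_eq_right (by linarith), max_eq_left (by linarith : 0 ≤ p / 2),
      abs_of_nonneg (by linarith : 0 ≤ p / 2), max_eq_right (by linarith),
      show p - p / 2 - p / 2 = 0 by ring]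
    simp

lemma gap_le_of_le_mul_abs (hc : 0 ≤ c) (hc1 : c ≤ 1) (hx' : s ≤ c * |x'|) (w : ℝ) :
    max (s - |w|) 0 ≤ c * |w - x'| := by
  refine max_le ?_ (by positivity)
  have := abs_sub_abs_le_abs_sub x' w
  rw [abs_sub_comm] at this
  nlinarith [abs_nonneg w]

lemma Thresholded.hasProxGrowth (hs : 0 ≤ s) (hc : 0 ≤ c) (hc1 : c ≤ 1)
    (h : Thresholded s c z x) : HasProxGrowth (scalarEnvelope s) (1 - c) z x := by
  rw [hasProxGrowth_scalar_iff]
  intro w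
  rcases h with ⟨rfl, hz⟩ | ⟨rfl, hz⟩
  · have hzw : z * w ≤ c * s * |w| := mul_le_mul_abs_of_abs_le hz w
    have h0 : scalarEnvelope s 0 = 0 := by simp [scalarEnvelope, hs]
    have hnonneg := mul_nonneg (sub_nonneg.2 hc1) (scalarEnvelope_nonneg hs w)
    have hlin := mul_le_mul_of_nonneg_left (two_mul_abs_le_scalarEnvelope_add_sq s w) hc
    rw [h0]
    linarith
  · have hgap : max (s - |w|) 0 ^ 2 ≤ c * (w - x) ^ 2 := by
      calc max (s - |w|) 0 ^ 2 ≤ (c * |w - x|) ^ 2 :=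
            pow_le_pow_left₀ (le_max_right _ _) (gap_le_of_le_mul_abs hc hc1 hz w) 2
        _ = c * (c * (w - x) ^ 2) := by rw [mul_pow, sq_abs]; ring
        _ ≤ c * (w - x) ^ 2 :=
            mul_le_mul_of_nonneg_left (mul_le_of_le_one_left (sq_nonneg _) hc1) hc
    unfold scalarEnvelope
    linarith [sq_nonneg (max (s - |x|) 0)]

lemma Thresholded.mul_sq_le (hc : 0 ≤ c) (hc1 : c ≤ 1) (h' : Thresholded s c z' x')
    (h : ScalarProx s z x) : (1 - c) * (x - x') ^ 2 ≤ (z - z') * (x - x') := by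
  obtain ⟨hle, hx⟩ := h
  rcases h' with ⟨rfl, hz'⟩ | ⟨rfl, hz'⟩
  · have hzx : z' * x ≤ c * s * |x| := mul_le_mul_abs_of_abs_le hz' x
    have hgap : c * (s - |x|) ≤ max (s - |x|) 0 :=
      (mul_le_mul_of_nonneg_left (le_max_left _ _) hc).trans
        (mul_le_of_le_one_left (le_max_right _ _) hc1)
    nlinarith [mul_le_mul_of_nonneg_right hgap (abs_nonneg x), abs_mul_abs_self x]
  · have hmul := mul_le_mul_abs_of_abs_le
      ((abs_sub_comm x z).trans_le (hle.trans (gap_le_of_le_mul_abs hc hc1 hz' x))) (x - x')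
    rw [mul_assoc, abs_mul_abs_self] at hmul
    linarith

lemma Thresholded.scalarEnvelope_eq (hs : 0 ≤ s) (hc1 : c ≤ 1) (h : Thresholded s c z x) :
    scalarEnvelope s x = if x = 0 then 0 else s ^ 2 := by
  unfold scalarEnvelope
  split_ifs with hx
  · simp [hx, hs]
  · obtain ⟨rfl, hz⟩ := h.resolve_left fun h => hx h.1
    rw [max_eq_right (by nlinarith [abs_nonneg x])]
    ring

lemma ScalarProx.eq_zero_of_abs_lt (h : ScalarProx s z x) (hz : |z| < s) : x = 0 := by
  by_contra hx
  have hzx : z * x < s * |x| :=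
    (le_abs_self _).trans_lt (by rw [abs_mul]; gcongr)
  nlinarith [h.2, mul_le_mul_of_nonneg_right (le_max_left (s - |x|) 0) (abs_nonneg x),
    abs_mul_abs_self x]

lemma ScalarProx.eq_of_lt_abs (h : ScalarProx s z x) (hz : s < |z|) : x = z := by
  have hle := h.1
  rcases max_cases (s - |x|) 0 with ⟨hmax, -⟩ | ⟨hmax, -⟩ <;> rw [hmax] at hle
  · linarith [abs_sub_abs_le_abs_sub z x]
  · exact (sub_eq_zero.1 (abs_nonpos_iff.1 hle)).symm

lemma ScalarProx.eventually_thresholded (hs : 0 ≤ s) (hc : 0 < c) (hc1 : c ≤ 1)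
    (h : ScalarProx s z x) (hz : z = 0 ∨ |z| ∉ Set.Icc (c * s) (1 / c * s)) :
    ∀ᶠ c' in 𝓝[<] c, Thresholded s c' z x := by
  rcases hz with rfl | hz
  · have hx : x = 0 := by
      have := h.2
      nlinarith [mul_nonneg (le_max_right (s - |x|) 0) (abs_nonneg x)]
    filter_upwards [nhdsWithin_le_nhds (lt_mem_nhds hc)] with c' hc'
    exact Or.inl ⟨hx, by rw [abs_zero]; positivity⟩
  rw [Set.mem_Icc, not_and_or, not_le, not_le, one_div, inv_mul_lt_iff₀ hc] at hz
  rcases hz with hz | hz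
  · have ht : ∀ᶠ c' in 𝓝[<] c, |z| < c' * s :=
      nhdsWithin_le_nhds <|
        (continuous_id.mul continuous_const).continuousAt.eventually_const_lt hz
    filter_upwards [ht] with c' hc'
    exact Or.inl ⟨h.eq_zero_of_abs_lt (hz.trans_le (mul_le_of_le_one_left hs hc1)), hc'.le⟩
  · have ht : ∀ᶠ c' in 𝓝[<] c, s < c' * |z| :=
      nhdsWithin_le_nhds <|
        (continuous_id.mul continuous_const).continuousAt.eventually_const_lt hz
    filter_upwards [ht] with c' hc'
    exact Or.inr ⟨h.eq_of_lt_abs (hz.trans_le (mul_le_of_le_one_left (abs_nonneg z) hc1)), hc'.le⟩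

end Scalar

section Unitary

open Matrix

variable {𝕜 : Type*} [RCLike 𝕜] {ι : Type*} [Fintype ι] [DecidableEq ι]

lemma sum_norm_sq_row_eq_one (W : unitaryGroup ι 𝕜) (i : ι) : ∑ j, ‖W.1 i j‖ ^ 2 = 1 := by
  have h := congrFun (congrFun (mem_unitaryGroup_iff.1 W.2) i) i
  rw [mul_apply, one_apply_eq] at h
  simp only [star_apply, RCLike.star_def, RCLike.mul_conj] at h
  exact_mod_cast h

lemma sum_norm_sq_col_eq_one (W : unitaryGroup ι 𝕜) (j : ι) : ∑ i, ‖W.1 i j‖ ^ 2 = 1 := by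
  simpa [star_apply] using sum_norm_sq_row_eq_one (star W) j

lemma sum_add_sum_le_sum_norm_sq_mul (W : unitaryGroup ι 𝕜) {a b : ι → ℝ} {φ : ι → ι → ℝ}
    (h : ∀ i j, a i + b j ≤ φ i j) :
    ∑ i, a i + ∑ j, b j ≤ ∑ i, ∑ j, ‖W.1 i j‖ ^ 2 * φ i j := by
  have ha : ∑ i, a i = ∑ i, ∑ j, ‖W.1 i j‖ ^ 2 * a i :=
    Finset.sum_congr rfl fun i _ => by rw [← Finset.sum_mul, sum_norm_sq_row_eq_one, one_mul]
  have hb : ∑ j, b j = ∑ i, ∑ j, ‖W.1 i j‖ ^ 2 * b j := by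
    rw [Finset.sum_comm]
    exact Finset.sum_congr rfl fun j _ => by
      rw [← Finset.sum_mul, sum_norm_sq_col_eq_one, one_mul]
  rw [ha, hb]
  simp only [← Finset.sum_add_distrib, ← mul_add]
  exact Finset.sum_le_sum fun i _ => Finset.sum_le_sum fun j _ =>
    mul_le_mul_of_nonneg_left (h i j) (sq_nonneg _)

/-- The columns of `U` are eigenvectors of `S`, with eigenvalues `x`. Unlike in Mathlib's spectral
theorem the eigenvalues come in any order, so that several matrices can share `U`. -/
def Diagonalizes (U : unitaryGroup ι 𝕜) (x : ι → ℝ) (S : Matrix ι ι 𝕜) : Prop :=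
  S = U.1 * diagonal (fun i => (x i : 𝕜)) * star U.1

lemma exists_diagonalizes {S : Matrix ι ι 𝕜} (hS : S.IsHermitian) : ∃ U x, Diagonalizes U x S :=
  ⟨hS.eigenvectorUnitary, hS.eigenvalues,
    hS.spectral_theorem.trans (Unitary.conjStarAlgAut_apply _ _)⟩

variable {U V : unitaryGroup ι 𝕜} {x x' y y' : ι → ℝ} {S S' T T' : Matrix ι ι 𝕜}

lemma Diagonalizes.isHermitian (h : Diagonalizes U x S) : S.IsHermitian := by
  rw [h, star_eq_conjTranspose]
  exact isHermitian_mul_mul_conjTranspose _ (isHermitian_diagonal_of_self_adjoint _ (by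
    ext i; simp))

lemma Diagonalizes.sub (h : Diagonalizes U x S) (h' : Diagonalizes U x' S') :
    Diagonalizes U (fun i => x i - x' i) (S - S') := by
  rw [Diagonalizes, h, h', ← Matrix.sub_mul, ← Matrix.mul_sub, diagonal_sub]
  simp only [RCLike.ofReal_sub]

lemma Diagonalizes.mul_eq (h : Diagonalizes U x S) :
    S * U.1 = U.1 * diagonal (fun i => (x i : 𝕜)) := by
  rw [h, Matrix.mul_assoc, UnitaryGroup.star_mul_self, Matrix.mul_one]

lemma Diagonalizes.star_mul_eq (h : Diagonalizes U x S) :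
    star U.1 * S = diagonal (fun i => (x i : 𝕜)) * star U.1 := by
  rw [h, ← Matrix.mul_assoc, ← Matrix.mul_assoc, UnitaryGroup.star_mul_self, Matrix.one_mul]

lemma Diagonalizes.star_mul_sub_mul_apply (hS : Diagonalizes U x S) (hT : Diagonalizes V y T)
    (i j : ι) :
    (star U.1 * (S - T) * V.1) i j = ((x i - y j : ℝ) : 𝕜) * (star U * V).1 i j := by
  rw [Matrix.mul_sub, Matrix.sub_mul, hS.star_mul_eq, Matrix.mul_assoc, Matrix.mul_assoc _ T,
    hT.mul_eq, ← Matrix.mul_assoc (star U.1) V.1, Matrix.sub_apply, diagonal_mul, mul_diagonal,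
    RCLike.ofReal_sub, sub_mul, mul_comm _ (y j : 𝕜)]
  rfl

lemma Diagonalizes.re_trace_sub_mul_sub (hS : Diagonalizes U x S) (hS' : Diagonalizes U x' S')
    (hT : Diagonalizes V y T) (hT' : Diagonalizes V y' T') :
    RCLike.re (trace ((S - T) * (S' - T'))) =
      ∑ i, ∑ j, ‖(star U * V).1 i j‖ ^ 2 * ((x i - y j) * (x' i - y' j)) := by
  have hH : star (S' - T') = S' - T' := hS'.isHermitian.sub hT'.isHermitian
  have htrace : trace ((S - T) * (S' - T')) =
      trace (star U.1 * (S - T) * V.1 * star (star U.1 * (S' - T') * V.1)) := by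
    rw [star_mul, star_mul, star_star, hH, ← Matrix.mul_assoc, Matrix.mul_assoc _ V.1,
      mem_unitaryGroup_iff.1 V.2, Matrix.mul_one, ← Matrix.mul_assoc, trace_mul_comm _ U.1]
    simp only [← Matrix.mul_assoc, mem_unitaryGroup_iff.1 U.2, Matrix.one_mul]
  rw [htrace, trace, map_sum]
  refine Finset.sum_congr rfl fun i _ => ?_
  rw [diag_apply, mul_apply, map_sum]
  refine Finset.sum_congr rfl fun j _ => ?_
  rw [star_apply, hS.star_mul_sub_mul_apply hT, hS'.star_mul_sub_mul_apply hT', star_mul']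
  simp only [RCLike.star_def, RCLike.conj_ofReal]
  rw [mul_mul_mul_comm, RCLike.mul_conj]
  norm_cast
  ring

lemma Diagonalizes.rank_eq_sum (h : Diagonalizes U x S) :
    (S.rank : ℝ) = ∑ i, if x i = 0 then 0 else 1 := by
  have hdet : IsUnit (star U.1).det := UnitaryGroup.det_isUnit (star U)
  rw [h, rank_mul_eq_left_of_isUnit_det _ _ hdet,
    rank_mul_eq_right_of_isUnit_det _ _ (UnitaryGroup.det_isUnit U), rank_diagonal,
    Fintype.card_subtype, Finset.natCast_card_filter]
  simp [ite_not]

lemma mul_diagonal_comp_of_anticommute {ζ : ℝ → ℝ} (hζ : ∀ t, ζ (-t) = -ζ t)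
    (h : T * diagonal (fun i => (x i : 𝕜)) = -(diagonal (fun i => (x i : 𝕜)) * T)) :
    T * diagonal (fun i => (ζ (x i) : 𝕜)) = -(diagonal (fun i => (ζ (x i) : 𝕜)) * T) := by
  ext i j
  have hij := congrFun (congrFun h i) j
  rw [neg_apply, mul_diagonal, diagonal_mul, mul_comm, ← neg_mul] at hij ⊢
  rcases eq_or_ne (T i j) 0 with h0 | h0
  · simp only [h0, mul_zero]
  · have hx : x j = -x i := by exact_mod_cast mul_right_cancel₀ h0 hij
    rw [hx, hζ, RCLike.ofReal_neg]

lemma Diagonalizes.map_anticommute {J : Matrix ι ι 𝕜} {ζ : ℝ → ℝ} (hζ : ∀ t, ζ (-t) = -ζ t)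
    (hS : Diagonalizes U x S) (hT : Diagonalizes U (fun i => ζ (x i)) T)
    (hJ : J * S = -(S * J)) : J * T = -(T * J) := by
  have hconj {y : ι → ℝ} {R : Matrix ι ι 𝕜} (hR : Diagonalizes U y R) :
      star U.1 * J * U.1 * diagonal (fun i => (y i : 𝕜)) = star U.1 * (J * R) * U.1 ∧
      diagonal (fun i => (y i : 𝕜)) * (star U.1 * J * U.1) = star U.1 * (R * J) * U.1 := by
    constructor
    · simp only [Matrix.mul_assoc, hR.mul_eq]
    · simp only [← Matrix.mul_assoc, hR.star_mul_eq]
  have hdiag := mul_diagonal_comp_of_anticommute hζ (x := x) (T := star U.1 * J * U.1) (by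
    rw [(hconj hS).1, (hconj hS).2, hJ, Matrix.mul_neg, Matrix.neg_mul])
  rw [(hconj hT).1, (hconj hT).2, ← Matrix.neg_mul, ← Matrix.mul_neg] at hdiag
  have hinj := congrArg (fun M => U.1 * M * star U.1) hdiag
  simpa only [← Matrix.mul_assoc, mem_unitaryGroup_iff.1 U.2, Matrix.one_mul,
    Matrix.mul_assoc _ U.1, Matrix.mul_one] using hinj

end Unitary

section Dilation

open Matrix

variable {𝕜 : Type*} [RCLike 𝕜]

/-- The Hermitian dilation of a rectangular matrix; its nonzero eigenvalues are the nonzero singular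
values and their negatives. -/
def dilation {m n : Type*} (X : Matrix m n 𝕜) : Matrix (m ⊕ n) (m ⊕ n) 𝕜 :=
  fromBlocks 0 X Xᴴ 0

section Blocks

variable {m n : Type*}

lemma isHermitian_dilation (X : Matrix m n 𝕜) : (dilation X).IsHermitian := by
  simp [dilation, IsHermitian, fromBlocks_conjTranspose]

lemma dilation_sub (X Y : Matrix m n 𝕜) : dilation (X - Y) = dilation X - dilation Y := by
  simp [dilation, sub_eq_add_neg, fromBlocks_neg, fromBlocks_add]

/-- The grading of the direct sum: Hermitian matrices that anticommute with it are exactly the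
dilations. -/
def grading (m n 𝕜 : Type*) [RCLike 𝕜] [DecidableEq m] [DecidableEq n] :
    Matrix (m ⊕ n) (m ⊕ n) 𝕜 :=
  fromBlocks 1 0 0 (-1)

variable [Fintype m] [Fintype n] [DecidableEq m] [DecidableEq n]

lemma grading_mul_dilation (X : Matrix m n 𝕜) :
    grading m n 𝕜 * dilation X = -(dilation X * grading m n 𝕜) := by
  simp [grading, dilation, fromBlocks_multiply, fromBlocks_neg]

lemma eq_dilation_of_anticommute {M : Matrix (m ⊕ n) (m ⊕ n) 𝕜} (hM : M.IsHermitian)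
    (hJ : grading m n 𝕜 * M = -(M * grading m n 𝕜)) : M = dilation M.toBlocks₁₂ := by
  rw [← fromBlocks_toBlocks M] at hM hJ
  obtain ⟨-, h₁₂, -, -⟩ := isHermitian_fromBlocks_iff.1 hM
  rw [grading, fromBlocks_multiply, fromBlocks_multiply, fromBlocks_neg, fromBlocks_inj] at hJ
  simp only [Matrix.one_mul, Matrix.mul_one, Matrix.zero_mul, Matrix.mul_zero, add_zero, zero_add,
    Matrix.neg_mul, Matrix.mul_neg, neg_neg] at hJ
  have h₁₁ : M.toBlocks₁₁ = 0 := by ext i j; exact self_eq_neg.1 (congrFun₂ hJ.1 i j)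
  have h₂₂ : M.toBlocks₂₂ = 0 := by ext i j; exact neg_eq_self.1 (congrFun₂ hJ.2.2.2 i j)
  conv_lhs => rw [← fromBlocks_toBlocks M, h₁₁, h₂₂, ← h₁₂]
  rfl

/- Oddness makes `ζ (dilation X)` anticommute with the grading, hence a dilation again. -/
lemma Diagonalizes.exists_dilation_map {U : unitaryGroup (m ⊕ n) 𝕜} {x : m ⊕ n → ℝ}
    {X : Matrix m n 𝕜} (hX : Diagonalizes U x (dilation X)) {ζ : ℝ → ℝ}
    (hζ : ∀ t, ζ (-t) = -ζ t) :
    ∃ Y : Matrix m n 𝕜, Diagonalizes U (fun i => ζ (x i)) (dilation Y) := by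
  have hM : Diagonalizes U (fun i => ζ (x i)) _ := rfl
  have hdil := eq_dilation_of_anticommute hM.isHermitian
    (hX.map_anticommute hζ hM (grading_mul_dilation X))
  exact ⟨_, hdil ▸ hM⟩

end Blocks

section Rank

lemma finrank_submodule_prod {K E F : Type*} [DivisionRing K] [AddCommGroup E] [AddCommGroup F]
    [Module K E] [Module K F] [FiniteDimensional K E] [FiniteDimensional K F]
    (p : Submodule K E) (q : Submodule K F) :
    Module.finrank K (p.prod q) = Module.finrank K p + Module.finrank K q := by
  have hrange : p.prod q = (p.subtype.prodMap q.subtype).range := by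
    rw [LinearMap.range_prodMap, p.range_subtype, q.range_subtype]
  rw [hrange, LinearMap.finrank_range_of_inj, Module.finrank_prod]
  exact Function.Injective.prodMap Subtype.val_injective Subtype.val_injective

lemma rank_fromBlocks_zero_zero {K l m n o : Type*} [Field K] [Fintype l] [Fintype m] [Finite n]
    [Finite o] (B : Matrix n l K) (C : Matrix o m K) :
    (fromBlocks B 0 0 C).rank = B.rank + C.rank := by
  let e₁ := LinearEquiv.sumArrowLequivProdArrow l m K K
  let e₂ := LinearEquiv.sumArrowLequivProdArrow n o K K
  have h : (fromBlocks B 0 0 C).mulVecLin = (e₂.symm : _ →ₗ[K] _) ∘ₗ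
      (B.mulVecLin.prodMap C.mulVecLin) ∘ₗ (e₁ : _ →ₗ[K] _) := by
    refine LinearMap.ext fun v => ?_
    ext (i | i) <;>
    simp [fromBlocks_mulVec, e₁, e₂, LinearEquiv.sumArrowLequivProdArrow,
      Equiv.sumArrowEquivProdArrow, Function.comp_def]
  rw [rank, h, LinearMap.range_comp, LinearEquiv.finrank_map_eq,
    LinearMap.range_comp_of_range_eq_top _ (LinearEquiv.range _), LinearMap.range_prodMap,
    finrank_submodule_prod]
  rfl

open scoped ComplexOrder in
lemma rank_dilation {m n : Type*} [Fintype m] [Fintype n] (X : Matrix m n 𝕜) :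
    (dilation X).rank = 2 * X.rank := by
  have hswap : dilation X = (fromBlocks X 0 0 Xᴴ).submatrix (Equiv.refl _) (Equiv.sumComm m n) :=
    (fromBlocks_submatrix_sum_swap_right ..).symm
  rw [hswap, rank_submatrix, rank_fromBlocks_zero_zero, rank_conjTranspose, two_mul]

end Rank

end Dilation

section SpectralFunction

open Matrix

variable {𝕜 : Type*} [RCLike 𝕜] {n₁ n₂ : ℕ} {U V : unitaryGroup (Fin n₁ ⊕ Fin n₂) 𝕜}
  {x x' y y' : Fin n₁ ⊕ Fin n₂ → ℝ} {X X' Y Y' : Matrix (Fin n₁) (Fin n₂) 𝕜}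

lemma two_mul_inner_eq_re_trace (X Y : Matrix (Fin n₁) (Fin n₂) 𝕜) :
    2 * inner ℝ X Y = RCLike.re (trace (dilation X * dilation Y)) := by
  have hstar : trace (X * Yᴴ) = star (trace (Xᴴ * Y)) := by
    rw [← trace_conjTranspose, conjTranspose_mul, conjTranspose_conjTranspose, trace_mul_comm]
  have hinner : inner ℝ X Y = RCLike.re (trace (Xᴴ * Y)) := rfl
  have htrace : trace (dilation X * dilation Y) = trace (X * Yᴴ) + trace (Xᴴ * Y) := by
    simp [dilation, fromBlocks_multiply, trace]
  rw [htrace, hstar, map_add, RCLike.star_def, RCLike.conj_re, hinner, two_mul]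

lemma two_mul_inner_sub_sub (hX : Diagonalizes U x (dilation X))
    (hX' : Diagonalizes U x' (dilation X')) (hY : Diagonalizes V y (dilation Y))
    (hY' : Diagonalizes V y' (dilation Y')) :
    2 * inner ℝ (X - Y) (X' - Y') =
      ∑ i, ∑ j, ‖(star U * V).1 i j‖ ^ 2 * ((x i - y j) * (x' i - y' j)) := by
  rw [two_mul_inner_eq_re_trace, dilation_sub, dilation_sub, hX.re_trace_sub_mul_sub hX' hY hY']

lemma two_mul_norm_sub_sq (hX : Diagonalizes U x (dilation X))
    (hY : Diagonalizes V y (dilation Y)) :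
    2 * ‖X - Y‖ ^ 2 = ∑ i, ∑ j, ‖(star U * V).1 i j‖ ^ 2 * (x i - y j) ^ 2 := by
  simp only [← real_inner_self_eq_norm_sq, two_mul_inner_sub_sub hX hX hY hY, sq (_ - _)]

lemma two_mul_norm_sub_sq_of_same (hX : Diagonalizes U x (dilation X))
    (hY : Diagonalizes U y (dilation Y)) : 2 * ‖X - Y‖ ^ 2 = ∑ i, (x i - y i) ^ 2 := by
  rw [two_mul_norm_sub_sq hX hY]
  simp [one_apply, apply_ite norm, ite_pow]

/-- `F` is the function of the singular values with `F X = ½ ∑ᵢ f (xᵢ)`, where `xᵢ` runs over the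
eigenvalues of the dilation of `X`. For `f` even with `f 0 = 0` the right-hand side is the sum of
`f` over the singular values. -/
def IsSpectral (F : Matrix (Fin n₁) (Fin n₂) 𝕜 → ℝ) (f : ℝ → ℝ) : Prop :=
  ∀ ⦃U x X⦄, Diagonalizes U x (dilation X) → 2 * F X = ∑ i, f (x i)

/- A supremum over `t` attained at an odd function of the parameter lifts to matrices, because
the optimizer is again a dilation. -/
lemma IsSpectral.sTransform_of_odd {F : Matrix (Fin n₁) (Fin n₂) 𝕜 → ℝ} {f g ω : ℝ → ℝ} {γ : ℝ}
    (hF : IsSpectral F f) (hω : ∀ t, ω (-t) = -ω t)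
    (hle : ∀ w t, -f w - γ / 2 * (w - t) ^ 2 ≤ g t)
    (heq : ∀ t, -f (ω t) - γ / 2 * (ω t - t) ^ 2 = g t) :
    IsSpectral (sTransform γ F) g := by
  intro U y Y hY
  have hupper (X : Matrix (Fin n₁) (Fin n₂) 𝕜) :
      -F X - γ / 2 * ‖X - Y‖ ^ 2 ≤ (∑ i, g (y i)) / 2 := by
    obtain ⟨V, x, hX⟩ := exists_diagonalizes (isHermitian_dilation X)
    have havg := sum_add_sum_le_sum_norm_sq_mul (star V * U) (a := fun i => -f (x i))
      (b := fun j => -g (y j)) (φ := fun i j => γ / 2 * (x i - y j) ^ 2)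
      fun i j => by linarith [hle (x i) (y j)]
    simp only [mul_left_comm _ (γ / 2), ← Finset.mul_sum, Finset.sum_neg_distrib,
      ← two_mul_norm_sub_sq hX hY] at havg
    linarith [hF hX]
  obtain ⟨X, hX⟩ := hY.exists_dilation_map hω
  have hattained : -F X - γ / 2 * ‖X - Y‖ ^ 2 = (∑ i, g (y i)) / 2 := by
    have hsum : ∑ i, g (y i) = -(2 * F X) - γ / 2 * (2 * ‖X - Y‖ ^ 2) := by
      rw [hF hX, two_mul_norm_sub_sq_of_same hX hY, Finset.mul_sum, ← Finset.sum_neg_distrib,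
        ← Finset.sum_sub_distrib]
      exact Finset.sum_congr rfl fun i _ => (heq (y i)).symm
    linarith
  have hS : sTransform γ F Y = (∑ i, g (y i)) / 2 :=
    le_antisymm (ciSup_le hupper)
      (hattained ▸ le_ciSup ⟨_, Set.forall_mem_range.2 hupper⟩ X)
  rw [hS]
  ring

lemma IsSpectral.hasProxGrowth {F : Matrix (Fin n₁) (Fin n₂) 𝕜 → ℝ} {f : ℝ → ℝ} {κ : ℝ}
    {z : Fin n₁ ⊕ Fin n₂ → ℝ} {Z : Matrix (Fin n₁) (Fin n₂) 𝕜} (hF : IsSpectral F f)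
    (hZ : Diagonalizes U z (dilation Z)) (hX : Diagonalizes U x (dilation X))
    (h : ∀ i, HasProxGrowth f κ (z i) (x i)) : HasProxGrowth F κ Z X := by
  intro W
  obtain ⟨V, w, hW⟩ := exists_diagonalizes (isHermitian_dilation W)
  have havg := sum_add_sum_le_sum_norm_sq_mul (star U * V)
    (a := fun i => f (x i) + (x i - z i) ^ 2) (b := fun j => -f (w j))
    (φ := fun i j => (z i - w j) ^ 2 - κ * (x i - w j) ^ 2)
    fun i j => by
      linarith [hasProxGrowth_scalar_iff.1 (h i) (w j), sub_sq_comm (w j) (z i),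
        sub_sq_comm (w j) (x i)]
  have hφ (p r s : ℝ) : p * (r - κ * s) = p * r - κ * (p * s) := by ring
  simp only [Finset.sum_neg_distrib, Finset.sum_add_distrib, hφ, Finset.sum_sub_distrib,
    ← Finset.mul_sum, ← two_mul_norm_sub_sq hZ hW, ← two_mul_norm_sub_sq hX hW,
    ← two_mul_norm_sub_sq_of_same hX hZ, ← hF hX, ← hF hW] at havg
  rw [norm_sub_rev W X, norm_sub_rev W Z]
  linarith

lemma mul_norm_sub_sq_le_inner {κ : ℝ} {z z' : Fin n₁ ⊕ Fin n₂ → ℝ}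
    {Z Z' : Matrix (Fin n₁) (Fin n₂) 𝕜} (hZ : Diagonalizes U z (dilation Z))
    (hX : Diagonalizes U x (dilation X)) (hZ' : Diagonalizes V z' (dilation Z'))
    (hX' : Diagonalizes V x' (dilation X'))
    (h : ∀ i j, κ * (x i - x' j) ^ 2 ≤ (z i - z' j) * (x i - x' j)) :
    κ * ‖X - X'‖ ^ 2 ≤ inner ℝ (Z - Z') (X - X') := by
  have havg := sum_add_sum_le_sum_norm_sq_mul (star U * V) (a := fun _ => 0) (b := fun _ => 0)
    (φ := fun i j => (z i - z' j) * (x i - x' j) - κ * (x i - x' j) ^ 2)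
    fun i j => by linarith [h i j]
  have hφ (p r s : ℝ) : p * (r - κ * s) = p * r - κ * (p * s) := by ring
  simp only [Finset.sum_const_zero, hφ, Finset.sum_sub_distrib, ← Finset.mul_sum,
    ← two_mul_norm_sub_sq hX hX', ← two_mul_inner_sub_sub hZ hX hZ' hX'] at havg
  linarith

end SpectralFunction

section RankEnvelope

open Matrix

variable {𝕜 : Type*} [RCLike 𝕜] {n₁ n₂ : ℕ}

lemma isSpectral_mul_rank (μ : ℝ) :
    IsSpectral (fun X : Matrix (Fin n₁) (Fin n₂) 𝕜 => μ * (X.rank : ℝ))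
      (fun t => if t = 0 then 0 else μ) := by
  intro U x X hX
  have hrank : 2 * (X.rank : ℝ) = ∑ i, if x i = 0 then 0 else 1 := by
    rw [← hX.rank_eq_sum, rank_dilation]
    push_cast
    rfl
  rw [mul_left_comm, hrank, Finset.mul_sum]
  simp only [mul_ite, mul_zero, mul_one]

lemma IsSpectral.sTransform_of_rankPenalty {F : Matrix (Fin n₁) (Fin n₂) 𝕜 → ℝ} {s : ℝ}
    (hs : 0 ≤ s) (hF : IsSpectral F fun t => if t = 0 then 0 else s ^ 2) :
    IsSpectral (sTransform 2 F) fun t => -min (t ^ 2) (s ^ 2) := by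
  refine hF.sTransform_of_odd (ω := fun t => if |t| ≤ s then 0 else t) (fun t => ?_) (fun w t => ?_)
    fun t => ?_
  · simp only [abs_neg]
    split_ifs <;> simp
  · split_ifs with hw
    · rw [hw]
      linarith [min_le_left (t ^ 2) (s ^ 2)]
    · linarith [min_le_right (t ^ 2) (s ^ 2), sq_nonneg (w - t)]
  · rcases le_or_gt |t| s with ht | ht
    · rw [if_pos ht, if_pos rfl, min_eq_left (sq_le_sq' (abs_le.1 ht).1 (abs_le.1 ht).2)]
      ring
    · have ht0 : t ≠ 0 := abs_pos.1 (hs.trans_lt ht)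
      rw [if_neg ht.not_ge, if_neg ht0, min_eq_right (sq_abs t ▸ pow_le_pow_left₀ hs ht.le 2)]
      ring

lemma min_sq_sub_sq_le_scalarEnvelope (s w t : ℝ) :
    min (w ^ 2) (s ^ 2) - (w - t) ^ 2 ≤ scalarEnvelope s t := by
  have hdist : (|w| - |t|) ^ 2 ≤ (w - t) ^ 2 := sq_le_sq.2 (abs_abs_sub_abs_le w t)
  rw [scalarEnvelope]
  rcases max_cases (s - |t|) 0 with ⟨h, h0⟩ | ⟨h, -⟩ <;> rw [h]
  · rcases le_total |w| s with hw | hw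
    · nlinarith [min_le_left (w ^ 2) (s ^ 2), mul_le_mul_of_nonneg_right hw (abs_nonneg t),
        sq_abs w]
    · have hgap : (s - |t|) ^ 2 ≤ (|w| - |t|) ^ 2 := pow_le_pow_left₀ h0 (by linarith) 2
      linarith [min_le_right (w ^ 2) (s ^ 2)]
  · linarith [min_le_right (w ^ 2) (s ^ 2), sq_nonneg (w - t)]

lemma min_sq_sub_sq_eq_scalarEnvelope {s : ℝ} (hs : 0 ≤ s) (t : ℝ) :
    min ((SignType.sign t * max |t| s) ^ 2) (s ^ 2) - (SignType.sign t * max |t| s - t) ^ 2 =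
      scalarEnvelope s t := by
  rcases eq_or_ne t 0 with rfl | ht
  · simp [scalarEnvelope, hs]
  have hsign : (SignType.sign t : ℝ) ^ 2 = 1 := by
    rcases ht.lt_or_gt with ht | ht <;> simp [ht]
  have hdist : SignType.sign t * max |t| s - t = SignType.sign t * max (s - |t|) 0 := by
    rw [max_comm (s - |t|), ← sub_self |t|, max_sub_sub_right, mul_sub, sign_mul_abs]
  rw [hdist, mul_pow, mul_pow, hsign, one_mul, one_mul, scalarEnvelope,
    min_eq_right (pow_le_pow_left₀ hs (le_max_right _ _) 2)]

lemma IsSpectral.sTransform_of_neg_min_sq {F : Matrix (Fin n₁) (Fin n₂) 𝕜 → ℝ} {s : ℝ}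
    (hs : 0 ≤ s) (hF : IsSpectral F fun t => -min (t ^ 2) (s ^ 2)) :
    IsSpectral (sTransform 2 F) (scalarEnvelope s) := by
  refine hF.sTransform_of_odd (ω := fun t => SignType.sign t * max |t| s) (fun t => ?_)
    (fun w t => ?_) fun t => ?_
  · simp only [abs_neg, Left.sign_neg, SignType.coe_neg, neg_mul]
  · linarith [min_sq_sub_sq_le_scalarEnvelope s w t]
  · linarith [min_sq_sub_sq_eq_scalarEnvelope hs t]

/-- The quadratic envelope `Q₂(μ rank)`. -/
def rankEnvelope (μ : ℝ) : Matrix (Fin n₁) (Fin n₂) 𝕜 → ℝ :=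
  quadEnvelope 2 fun Y => μ * (Y.rank : ℝ)

lemma isSpectral_rankEnvelope {μ : ℝ} (hμ : 0 ≤ μ) :
    IsSpectral (rankEnvelope (𝕜 := 𝕜) (n₁ := n₁) (n₂ := n₂) μ) (scalarEnvelope √μ) := by
  have hs := Real.sqrt_nonneg μ
  refine IsSpectral.sTransform_of_neg_min_sq hs (IsSpectral.sTransform_of_rankPenalty hs ?_)
  rw [Real.sq_sqrt hμ]
  exact isSpectral_mul_rank μ

lemma bddBelow_range_mul_rank {μ : ℝ} (hμ : 0 ≤ μ) :
    BddBelow (Set.range fun X : Matrix (Fin n₁) (Fin n₂) 𝕜 => μ * (X.rank : ℝ)) :=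
  ⟨0, Set.forall_mem_range.2 fun _ => by positivity⟩

variable {μ : ℝ} {X Z : Matrix (Fin n₁) (Fin n₂) 𝕜}

/- Minty's argument: the pair `(X, Z)` is determined by `X + Z`, and the scalar resolvent produces
a pair with the same sum out of an eigenbasis of the dilation of `X + Z`. -/
lemma HasProxGrowth.exists_scalarProx (hμ : 0 ≤ μ) (h : HasProxGrowth (rankEnvelope μ) 0 Z X) :
    ∃ U x z, Diagonalizes U x (dilation X) ∧ Diagonalizes U z (dilation Z) ∧
      ∀ i, ScalarProx √μ (z i) (x i) := by
  obtain ⟨U, p, hP⟩ := exists_diagonalizes (isHermitian_dilation (X + Z))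
  obtain ⟨X₁, hX₁⟩ := hP.exists_dilation_map (scalarResolvent_neg √μ)
  have hZ₁ := hP.sub hX₁
  rw [← dilation_sub] at hZ₁
  have hprox (i) := scalarProx_scalarResolvent (Real.sqrt_nonneg μ) (p i)
  have h₁ := (isSpectral_rankEnvelope hμ).hasProxGrowth hZ₁ hX₁ fun i => (hprox i).hasProxGrowth
  obtain ⟨rfl, hZ⟩ := h.eq_of_add_eq_add h₁ (by abel)
  exact ⟨U, _, _, hX₁, hZ ▸ hZ₁, hprox⟩

end RankEnvelope

section SingularValues

open Matrix

variable {𝕜 : Type*} [RCLike 𝕜] {n₁ n₂ : ℕ} {Z : Matrix (Fin n₁) (Fin n₂) 𝕜}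

lemma exists_sigma_eq_abs {t : ℝ} (ht : t ≠ 0) {u : Fin n₁ → 𝕜} {v : Fin n₂ → 𝕜} (hv : v ≠ 0)
    (hZv : Z *ᵥ v = (t : 𝕜) • u) (hZu : Zᴴ *ᵥ u = (t : 𝕜) • v) : ∃ i, sigma Z i = |t| := by
  set T := Matrix.toEuclideanLin Z with hT
  have hTv : (LinearMap.adjoint T ∘ₗ T) (WithLp.toLp 2 v) =
      ((t ^ 2 : ℝ) : 𝕜) • WithLp.toLp 2 v := by
    rw [LinearMap.comp_apply, hT, ← Matrix.toEuclideanLin_conjTranspose_eq_adjoint]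
    simp only [Matrix.toLpLin_toLp, toLin'_apply, hZv, mulVec_smul, hZu]
    rw [smul_smul, ← WithLp.toLp_smul, sq, RCLike.ofReal_mul]
  have heig : Module.End.HasEigenvalue (LinearMap.adjoint T ∘ₗ T) ((t ^ 2 : ℝ) : 𝕜) :=
    Module.End.hasEigenvalue_of_hasEigenvector
      ⟨Module.End.mem_eigenspace_iff.2 hTv, (WithLp.toLp_eq_zero 2).not.2 hv⟩
  obtain ⟨i, hi⟩ := T.isSymmetric_adjoint_comp_self.exists_eigenvalues_eq rfl heig
  have hσ : T.singularValues i = |t| := by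
    rw [T.singularValues_fin rfl, RCLike.ofReal_inj.1 hi, Real.sqrt_sq_eq_abs]
  have hpos : 0 < T.singularValues i := hσ ▸ abs_pos.2 ht
  rw [T.singularValues_pos_iff_lt_finrank_range] at hpos
  have hle₁ : Module.finrank 𝕜 (LinearMap.range T) ≤ n₁ := by
    simpa using Submodule.finrank_le (LinearMap.range T)
  have hle₂ : Module.finrank 𝕜 (LinearMap.range T) ≤ n₂ := by
    simpa using LinearMap.finrank_range_le T
  exact ⟨⟨i, lt_min (hpos.trans_le hle₁) (hpos.trans_le hle₂)⟩, hσ⟩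

lemma dilation_mulVec {m n : Type*} [Fintype m] [Fintype n] (Z : Matrix m n 𝕜)
    (w : m ⊕ n → 𝕜) :
    dilation Z *ᵥ w = Sum.elim (Z *ᵥ (w ∘ Sum.inr)) (Zᴴ *ᵥ (w ∘ Sum.inl)) := by
  simp [dilation, fromBlocks_mulVec]

lemma Diagonalizes.mulVec_col {ι : Type*} [Fintype ι] [DecidableEq ι] {U : unitaryGroup ι 𝕜}
    {x : ι → ℝ} {S : Matrix ι ι 𝕜} (h : Diagonalizes U x S) (j : ι) :
    S *ᵥ U.1.col j = (x j : 𝕜) • U.1.col j := by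
  ext i
  have := congrFun₂ h.mul_eq i j
  rw [mul_apply, mul_diagonal, mul_comm] at this
  exact this

lemma Diagonalizes.exists_sigma_eq {U : unitaryGroup (Fin n₁ ⊕ Fin n₂) 𝕜}
    {z : Fin n₁ ⊕ Fin n₂ → ℝ} (hZ : Diagonalizes U z (dilation Z)) {j : Fin n₁ ⊕ Fin n₂}
    (hj : z j ≠ 0) : ∃ i, sigma Z i = |z j| := by
  set w := U.1.col j
  have hw : w ≠ 0 := by
    intro h0
    have hcol := sum_norm_sq_col_eq_one U j
    simp [show ∀ i, U.1 i j = 0 from congrFun h0] at hcol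
  have heig := hZ.mulVec_col j
  rw [dilation_mulVec] at heig
  have hZv : Z *ᵥ (w ∘ Sum.inr) = (z j : 𝕜) • (w ∘ Sum.inl) :=
    funext fun i => congrFun heig (Sum.inl i)
  have hZu : Zᴴ *ᵥ (w ∘ Sum.inl) = (z j : 𝕜) • (w ∘ Sum.inr) :=
    funext fun i => congrFun heig (Sum.inr i)
  refine exists_sigma_eq_abs hj (fun hv => hw ?_) hZv hZu
  rw [hv, mulVec_zero, eq_comm, smul_eq_zero_iff_right (RCLike.ofReal_ne_zero.2 hj)] at hZv
  exact funext fun i => i.casesOn (congrFun hZv) (congrFun hv)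

end SingularValues

section SpectralGap

open Matrix

variable {𝕜 : Type*} [RCLike 𝕜] {n₁ n₂ : ℕ} {μ c : ℝ} {X Z X' Z' : Matrix (Fin n₁) (Fin n₂) 𝕜}

/-- Every singular value of `Z` differs from `√μ` by a factor larger than `1 / c`. For `c > 1` the
excluded interval may be empty, so that the condition is void. -/
def HasSpectralGap (c μ : ℝ) (Z : Matrix (Fin n₁) (Fin n₂) 𝕜) : Prop :=
  ∀ i, sigma Z i ∉ Set.Icc (c * √μ) (1 / c * √μ)

lemma HasSpectralGap.exists_thresholded (hZ : HasSpectralGap c μ Z) (hμ : 0 ≤ μ) (hc : 0 < c)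
    (hc1 : c ≤ 1) (h : HasProxGrowth (rankEnvelope μ) 0 Z X) :
    ∃ c' U x z, 0 ≤ c' ∧ c' < c ∧ Diagonalizes U x (dilation X) ∧ Diagonalizes U z (dilation Z) ∧
      ∀ i, Thresholded √μ c' (z i) (x i) := by
  obtain ⟨U, x, z, hXx, hZz, hprox⟩ := h.exists_scalarProx hμ
  have hgap (i) : z i = 0 ∨ |z i| ∉ Set.Icc (c * √μ) (1 / c * √μ) :=
    or_iff_not_imp_left.2 fun hz => by
      obtain ⟨j, hj⟩ := hZz.exists_sigma_eq hz
      exact hj ▸ hZ j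
  have hthr : ∀ᶠ c' in 𝓝[<] c, ∀ i, Thresholded √μ c' (z i) (x i) :=
    eventually_all.2 fun i =>
      (hprox i).eventually_thresholded (Real.sqrt_nonneg μ) hc hc1 (hgap i)
  have hpos : ∀ᶠ c' in 𝓝[<] c, 0 ≤ c' := nhdsWithin_le_nhds (le_mem_nhds hc)
  obtain ⟨c', hthr, hpos, hlt⟩ := (hthr.and (hpos.and self_mem_nhdsWithin)).exists
  exact ⟨c', U, x, z, hpos, hlt, hXx, hZz, hthr⟩

lemma HasSpectralGap.exists_hasProxGrowth (hZ : HasSpectralGap c μ Z) (hμ : 0 ≤ μ) (hc : 0 < c)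
    (h : HasProxGrowth (rankEnvelope μ) 0 Z X) :
    ∃ κ, 1 - c < κ ∧ HasProxGrowth (rankEnvelope μ) κ Z X := by
  rcases le_or_gt c 1 with hc1 | hc1
  · obtain ⟨c', U, x, z, hc', hlt, hXx, hZz, hthr⟩ := hZ.exists_thresholded hμ hc hc1 h
    exact ⟨1 - c', by linarith, (isSpectral_rankEnvelope hμ).hasProxGrowth hZz hXx fun i =>
      (hthr i).hasProxGrowth (Real.sqrt_nonneg μ) hc' (hlt.le.trans hc1)⟩
  · exact ⟨0, by linarith, h⟩

lemma HasSpectralGap.exists_mul_norm_sub_sq_le_inner (hZ' : HasSpectralGap c μ Z') (hμ : 0 ≤ μ)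
    (hc : 0 < c) (h' : HasProxGrowth (rankEnvelope μ) 0 Z' X')
    (h : HasProxGrowth (rankEnvelope μ) 0 Z X) :
    ∃ κ, 1 - c < κ ∧ κ * ‖X - X'‖ ^ 2 ≤ inner ℝ (Z - Z') (X - X') := by
  rcases le_or_gt c 1 with hc1 | hc1
  · obtain ⟨c', V, x', z', hc', hlt, hX'x, hZ'z, hthr⟩ := hZ'.exists_thresholded hμ hc hc1 h'
    obtain ⟨U, x, z, hXx, hZz, hprox⟩ := h.exists_scalarProx hμ
    exact ⟨1 - c', by linarith, mul_norm_sub_sq_le_inner hZz hXx hZ'z hX'x fun i j =>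
      (hthr j).mul_sq_le hc' (hlt.le.trans hc1) (hprox i)⟩
  · exact ⟨0, by linarith, by simpa using h.inner_sub_nonneg h'⟩

lemma HasSpectralGap.rankEnvelope_eq (hZ : HasSpectralGap c μ Z) (hμ : 0 ≤ μ) (hc : 0 < c)
    (hc1 : c ≤ 1) (h : HasProxGrowth (rankEnvelope μ) 0 Z X) : rankEnvelope μ X = μ * X.rank := by
  obtain ⟨c', U, x, z, -, hlt, hXx, -, hthr⟩ := hZ.exists_thresholded hμ hc hc1 h
  have henv := isSpectral_rankEnvelope hμ hXx
  have hrank := isSpectral_mul_rank μ hXx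
  simp only [(hthr _).scalarEnvelope_eq (Real.sqrt_nonneg μ) (hlt.le.trans hc1),
    Real.sq_sqrt hμ] at henv
  linarith

end SpectralGap

section RestrictedIsometry

lemma rank_sub_le_add {F m n : Type*} [Field F] [Finite m] [Fintype n] (X Y : Matrix m n F) :
    (X - Y).rank ≤ X.rank + Y.rank := by
  have h : LinearMap.range (X - Y).mulVecLin ≤
      LinearMap.range X.mulVecLin ⊔ LinearMap.range Y.mulVecLin := by
    rintro _ ⟨v, rfl⟩
    rw [Matrix.mulVecLin_apply, Matrix.sub_mulVec]
    exact sub_mem (Submodule.mem_sup_left ⟨v, rfl⟩) (Submodule.mem_sup_right ⟨v, rfl⟩)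
  exact (Submodule.finrank_mono h).trans (Submodule.finrank_add_le_finrank_add_finrank _ _)

variable {𝕜 : Type*} [RCLike 𝕜] {n₁ n₂ : ℕ} {H : Type*} [NormedAddCommGroup H]
  [InnerProductSpace ℝ H] {X Y : Matrix (Fin n₁) (Fin n₂) 𝕜} {K : ℕ}
  (A : Matrix (Fin n₁) (Fin n₂) 𝕜 →ₗ[ℝ] H)

lemma one_sub_lrip_mul_le (hX : X.rank ≤ K) : (1 - lrip A K) * ‖X‖ ^ 2 ≤ ‖A X‖ ^ 2 := by
  rcases eq_or_ne X 0 with rfl | h0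
  · simp
  have hbdd : BddBelow {r : ℝ | ∃ X : Matrix (Fin n₁) (Fin n₂) 𝕜,
      X ≠ 0 ∧ X.rank ≤ K ∧ r = ‖A X‖ ^ 2 / ‖X‖ ^ 2} :=
    ⟨0, by rintro _ ⟨X, -, -, rfl⟩; positivity⟩
  rw [← le_div_iff₀ (pow_pos (norm_pos_iff.2 h0) 2), lrip, sub_sub_cancel]
  exact csInf_le hbdd ⟨X, h0, hX, rfl⟩

lemma one_sub_lrip_mul_norm_sub_sq_le (hX : X.rank ≤ K) (hY : Y.rank ≤ K) :
    (1 - lrip A (2 * K)) * ‖X - Y‖ ^ 2 ≤ ‖A (X - Y)‖ ^ 2 :=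
  one_sub_lrip_mul_le A <| (rank_sub_le_add X Y).trans (by lia)

variable {A}

/- If there is no nonzero matrix of rank at most `K`, then `lrip A K` takes the junk value `1`. -/
lemma lrip_nonneg_of_contraction (hA : ∀ v, ‖A v‖ ≤ ‖v‖) (hδ : lrip A K < 1) : 0 ≤ lrip A K := by
  obtain ⟨X, hX, hXK⟩ : ∃ X : Matrix (Fin n₁) (Fin n₂) 𝕜, X ≠ 0 ∧ X.rank ≤ K := by
    by_contra! hne
    refine hδ.ne (sub_eq_self.2 ?_)
    convert Real.sInf_empty
    ext r
    simp only [Set.mem_ofPred_eq, Set.mem_empty_iff_false, iff_false]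
    rintro ⟨X, hX, hXK, -⟩
    exact (hne X hX).not_ge hXK
  have hle := (one_sub_lrip_mul_le A hXK).trans (pow_le_pow_left₀ (norm_nonneg _) (hA X) 2)
  rw [mul_le_iff_le_one_left (pow_pos (norm_pos_iff.2 hX) 2)] at hle
  linarith

end RestrictedIsometry

section StationaryPoints

variable {𝕜 : Type*} [RCLike 𝕜] {n₁ n₂ : ℕ} {H : Type*} [NormedAddCommGroup H]
  [InnerProductSpace ℝ H] {A : Matrix (Fin n₁) (Fin n₂) 𝕜 →ₗ[ℝ] H} {b : H} {μ : ℝ} {K : ℕ}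
  {X X' : Matrix (Fin n₁) (Fin n₂) 𝕜}

lemma setOf_isMinOn_eq_singleton {α β : Type*} [Preorder β] {f : α → β} {p : α → Prop} {a : α}
    (h : ∀ x, p x → x ≠ a → f a < f x) (ha : p a) : {x | p x ∧ IsMinOn f {y | p y} x} = {a} := by
  refine Set.eq_singleton_iff_unique_mem.2 ⟨⟨ha, fun x hx => ?_⟩, fun x ⟨hx, hmin⟩ => ?_⟩
  · rcases eq_or_ne x a with rfl | hne
    · exact le_rfl
    · exact (h x hx hne).le
  · by_contra hne
    exact (h x hx hne).not_ge (hmin ha)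

lemma regFunctional_le_rankFunctional (hμ : 0 ≤ μ) (X : Matrix (Fin n₁) (Fin n₂) 𝕜) :
    regFunctional μ A b X ≤ rankFunctional μ A b X :=
  add_le_add_left (quadEnvelope_le zero_le_two (bddBelow_range_mul_rank hμ) X) _

theorem isMinOn_rankFunctional_of_regFunctional_eq (hμ : 0 ≤ μ)
    (hmin : IsMinOn (regFunctional μ A b) {Y | Y.rank ≤ K} X')
    (htouch : regFunctional μ A b X' = rankFunctional μ A b X') (hrank : X'.rank ≤ K)
    (hb : ‖A X' - b‖ ^ 2 ≤ μ) : IsMinOn (rankFunctional μ A b) Set.univ X' := by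
  intro X _
  rcases le_or_gt X.rank K with hX | hX
  · exact (htouch.symm.trans_le (hmin hX)).trans (regFunctional_le_rankFunctional hμ X)
  · have hsucc : (X'.rank : ℝ) + 1 ≤ X.rank := by exact_mod_cast hrank.trans_lt hX
    calc rankFunctional μ A b X' ≤ μ * (X'.rank + 1) := by
          rw [rankFunctional]
          linarith
      _ ≤ μ * X.rank := mul_le_mul_of_nonneg_left hsucc hμ
      _ ≤ rankFunctional μ A b X := le_add_of_nonneg_right (sq_nonneg _)

variable [FiniteDimensional ℝ H]

lemma IsStationary.hasProxGrowth_rankEnvelope (hX : IsStationary (regFunctional μ A b) X)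
    (hμ : 0 ≤ μ) : HasProxGrowth (rankEnvelope μ) 0 (zPoint A b X) X :=
  hX.hasProxGrowth (bddBelow_range_mul_rank hμ)

theorem regFunctional_lt_of_hasSpectralGap (hμ : 0 ≤ μ) (hδ : lrip A (2 * K) < 1)
    (hX' : IsStationary (regFunctional μ A b) X') (hrank : X'.rank ≤ K)
    (hσ : HasSpectralGap (1 - lrip A (2 * K)) μ (zPoint A b X')) (hX : X.rank ≤ K) (hne : X ≠ X') :
    regFunctional μ A b X' < regFunctional μ A b X := by
  obtain ⟨κ, hκ, hgrowth⟩ :=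
    hσ.exists_hasProxGrowth hμ (sub_pos.2 hδ) (hX'.hasProxGrowth_rankEnvelope hμ)
  have hpos : 0 < ‖X - X'‖ ^ 2 := pow_pos (norm_pos_iff.2 (sub_ne_zero.2 hne)) 2
  have hrip := one_sub_lrip_mul_norm_sub_sq_le A hX hrank
  calc regFunctional μ A b X'
      < regFunctional μ A b X' + (‖A (X - X')‖ ^ 2 - (1 - κ) * ‖X - X'‖ ^ 2) := by
        nlinarith
    _ ≤ regFunctional μ A b X := hgrowth.add_residual_le X

theorem lt_rank_of_isStationary_of_ne (hμ : 0 ≤ μ) (hδ : lrip A (2 * K) < 1)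
    (hX' : IsStationary (regFunctional μ A b) X') (hrank : X'.rank ≤ K)
    (hσ : HasSpectralGap (1 - lrip A (2 * K)) μ (zPoint A b X'))
    (hX : IsStationary (regFunctional μ A b) X) (hne : X ≠ X') : K < X.rank := by
  by_contra! hXK
  obtain ⟨κ, hκ, hmono⟩ := hσ.exists_mul_norm_sub_sq_le_inner hμ (sub_pos.2 hδ)
    (hX'.hasProxGrowth_rankEnvelope hμ) (hX.hasProxGrowth_rankEnvelope hμ)
  rw [inner_zPoint_sub_zPoint] at hmono
  have hpos : 0 < ‖X - X'‖ ^ 2 := pow_pos (norm_pos_iff.2 (sub_ne_zero.2 hne)) 2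
  have hrip := one_sub_lrip_mul_norm_sub_sq_le A hXK hrank
  nlinarith

theorem regFunctional_eq_rankFunctional (hμ : 0 ≤ μ) (hδ : lrip A K < 1) (hA : ∀ v, ‖A v‖ ≤ ‖v‖)
    (hX : IsStationary (regFunctional μ A b) X)
    (hσ : HasSpectralGap (1 - lrip A K) μ (zPoint A b X)) :
    regFunctional μ A b X = rankFunctional μ A b X :=
  congrArg (· + ‖A X - b‖ ^ 2) <| hσ.rankEnvelope_eq hμ (sub_pos.2 hδ)
    (sub_le_self 1 (lrip_nonneg_of_contraction hA hδ)) (hX.hasProxGrowth_rankEnvelope hμ)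

theorem isMinOn_regFunctional_of_isMinOn_rankFunctional (hμ : 0 ≤ μ) (hA : ∀ v, ‖A v‖ ≤ ‖v‖)
    (hmin : IsMinOn (rankFunctional μ A b) Set.univ X') :
    IsMinOn (regFunctional μ A b) Set.univ X' := fun X _ =>
  (regFunctional_le_rankFunctional hμ X').trans <|
    le_quadEnvelope_add_of_contraction hA (bddBelow_range_mul_rank hμ)
      (fun W => hmin (Set.mem_univ W)) X

end StationaryPoints

end

end RankReg

theorem theorem5p1 {𝕜 : Type*} [RCLike 𝕜] {n₁ n₂ : ℕ}
    {H : Type*} [NormedAddCommGroup H] [InnerProductSpace ℝ H] [FiniteDimensional ℝ H]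
    (A : Matrix (Fin n₁) (Fin n₂) 𝕜 →ₗ[ℝ] H) (b : H) (μ : ℝ) (hμ : 0 ≤ μ) (K : ℕ)
    (hδ : RankReg.lrip A (2 * K) < 1)
    (X' : Matrix (Fin n₁) (Fin n₂) 𝕜)
    (hX' : RankReg.IsStationary (RankReg.regFunctional μ A b) X')
    (hrank : X'.rank ≤ K)
    (hσ : ∀ i, RankReg.sigma (RankReg.zPoint A b X') i ∉
      Set.Icc ((1 - RankReg.lrip A (2 * K)) * √μ) (1 / (1 - RankReg.lrip A (2 * K)) * √μ)) :
    {X : Matrix (Fin n₁) (Fin n₂) 𝕜 |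
        X.rank ≤ K ∧ IsMinOn (RankReg.regFunctional μ A b) {Y | Y.rank ≤ K} X} = {X'} ∧
    (∀ X'' : Matrix (Fin n₁) (Fin n₂) 𝕜,
      RankReg.IsStationary (RankReg.regFunctional μ A b) X'' → X'' ≠ X' → K < X''.rank) ∧
    (RankReg.opNorm A < 1 → ‖A X' - b‖ ^ 2 ≤ μ →
      IsMinOn (RankReg.rankFunctional μ A b) Set.univ X' ∧
      IsMinOn (RankReg.regFunctional μ A b) Set.univ X') := by
  open RankReg in
  have hlt (X : Matrix (Fin n₁) (Fin n₂) 𝕜) (hX : X.rank ≤ K) (hne : X ≠ X') :=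
    regFunctional_lt_of_hasSpectralGap hμ hδ hX' hrank hσ hX hne
  have hunique := setOf_isMinOn_eq_singleton hlt hrank
  refine ⟨hunique, fun X'' => lt_rank_of_isStationary_of_ne hμ hδ hX' hrank hσ, fun hA hb => ?_⟩
  have hcontr (v : Matrix (Fin n₁) (Fin n₂) 𝕜) : ‖A v‖ ≤ ‖v‖ :=
    (LinearMap.toContinuousLinearMap A).le_of_opNorm_le hA.le v |>.trans_eq (one_mul _)
  have hreg := regFunctional_eq_rankFunctional hμ hδ hcontr hX' hσ
  have hmin := isMinOn_rankFunctional_of_regFunctional_eq hμ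
    (hunique.ge (Set.mem_singleton X')).2 hreg hrank hb
  exact ⟨hmin, isMinOn_regFunctional_of_isMinOn_rankFunctional hμ hcontr hmin⟩
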